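/- Let $n\ge 3$ and let $\lambda_1,\dots,\lambda_n$ be positive integers. The sun graph $S(n;\lambda_1,\dots,\lambda_n)$ is obtained from the cycle $C_n$ with vertices $v_1,\dots,v_n$ (in cyclic order) and disjoint paths $P_{\lambda_1},\dots,P_{\lambda_n}$, where $P_{\lambda_i}$ has $\lambda_i$ vertices, by joining $v_i$ by an edge to an end vertex of $P_{\lambda_i}$ for each $i$; the complete sun graph $\overline{S}(n;\lambda_1,\dots,\lambda_n)$ is obtained in the same way from the complete graph $K_n$ in place of $C_n$. A connected partition of type $(\mu_1,\dots,\mu_k)$ of a graph $G$ is a partition of its vertex set into sets $V_1,\dots,V_k$ with $|V_j|=\mu_j$ such that every induced subgraph $G[V_j]$ is connected. A finite graph $G$ is $e$-positive if its chromatic symmetric function $X_G=\sum_{k}\prod_{v\in V(G)}x_{k(v)}$ (the sum over all proper colourings $k:V(G)\to\mathbb N$) has only nonnegative coefficients when expanded in the basis $\{e_\mu\}$ of products $e_\mu=e_{\mu_1}e_{\mu_2}\cdots$ of elementary symmetric functions, indexed by integer partitions $\mu$. **Theorem.** Suppose that $\lambda_1=\max\{\lambda_1,\dots,\lambda_n\}$,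 that $\gcd(\lambda_1+1,\lambda_2+1,\dots,\lambda_n+1)>1$, and that $\lambda_1+2\le \lambda_2+\cdots+\lambda_n+n-2$. Then neither $S(n;\lambda_1,\dots,\lambda_n)$ nor $\overline{S}(n;\lambda_1,\dots,\lambda_n)$ has a connected partition of type $(\lambda_2+\cdots+\lambda_n+n-2,\ \lambda_1+2)$. Moreover, neither of these graphs is $e$-positive. -/

import Mathlib

noncomputable section

/-- The graph obtained from a graph `H` on `v_0, …, v_{n-1}` and disjoint paths with
`l 0, …, l (n-1)` vertices by joining each `v_i` by an edge to an end vertex of the `i`-th path.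
The vertex `⟨i, 0⟩` is `v_i`, and `⟨i, 1⟩, …, ⟨i, l i⟩` are the successive vertices of the `i`-th
path, `⟨i, 1⟩` being the one that is joined to `v_i`. -/
def attachRays {n : ℕ} (H : SimpleGraph (Fin n)) (l : Fin n → ℕ) :
    SimpleGraph (Σ i : Fin n, Fin (l i + 1)) where
  Adj x y :=
    ((x.2 : ℕ) = 0 ∧ (y.2 : ℕ) = 0 ∧ H.Adj x.1 y.1) ∨
    (x.1 = y.1 ∧ ((x.2 : ℕ) + 1 = (y.2 : ℕ) ∨ (y.2 : ℕ) + 1 = (x.2 : ℕ)))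
  symm := ⟨by
    rintro x y (⟨hx, hy, h⟩ | ⟨h, h1 | h1⟩)
    · exact Or.inl ⟨hy, hx, h.symm⟩
    · exact Or.inr ⟨h.symm, Or.inr h1⟩
    · exact Or.inr ⟨h.symm, Or.inl h1⟩⟩
  loopless := ⟨by
    rintro x (⟨_, _, h⟩ | ⟨_, h1 | h1⟩)
    · exact H.irrefl h
    · omega
    · omega⟩

/-- The (ordinary) sun graph `S(n; l 0, …, l (n-1))`: the body is the cycle `C_n`. -/
def sunGraph {n : ℕ} (l : Fin n → ℕ) : SimpleGraph (Σ i : Fin n, Fin (l i + 1)) :=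
  attachRays (SimpleGraph.cycleGraph n) l

/-- The complete sun graph: the body is the complete graph `K_n`. -/
def completeSunGraph {n : ℕ} (l : Fin n → ℕ) : SimpleGraph (Σ i : Fin n, Fin (l i + 1)) :=
  attachRays (⊤ : SimpleGraph (Fin n)) l

/-- `G` has a connected partition of type `μ`: its vertex set can be partitioned into nonempty
sets, each inducing a connected subgraph, whose sizes form the multiset `μ`. -/
def HasConnectedPartition {V : Type*} [Fintype V] [DecidableEq V] (G : SimpleGraph V)
    (μ : Multiset ℕ) : Prop :=
  ∃ P : Finpartition (Finset.univ : Finset V),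
    (∀ A ∈ P.parts, (G.induce (A : Set V)).Connected) ∧ P.parts.val.map Finset.card = μ

/-- The chromatic symmetric function `X_G = ∑_k ∏_v x_{k(v)}` in `ℚ[[x_0, x_1, …]]`, the sum being
over all proper colourings `k` of `G` by natural numbers: the coefficient of the monomial `x ^ d`
is the (finite) number of proper colourings `k` with `∏_v x_{k(v)} = x ^ d`. -/
def chromaticSymmetricFunction {V : Type*} [Fintype V] (G : SimpleGraph V) : MvPowerSeries ℕ ℚ :=
  fun d => (Nat.card {k : G.Coloring ℕ // ∑ v : V, Finsupp.single (k v) 1 = d} : ℚ)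

open Classical in
/-- The elementary symmetric function `e_i` in `ℚ[[x_0, x_1, …]]`: the sum of all squarefree
monomials of degree `i`. -/
def elemSymm (i : ℕ) : MvPowerSeries ℕ ℚ :=
  fun d => if (∀ j, d j ≤ 1) ∧ d.degree = i then 1 else 0

/-- `e_μ`, the product of the `e_i` over the parts `i` of the partition `μ`. -/
def elemSymmPart {d : ℕ} (μ : d.Partition) : MvPowerSeries ℕ ℚ :=
  (μ.parts.map elemSymm).prod

/-- `G` is `e`-positive: `X_G` is a linear combination of the basis elements `e_μ`, `μ` running over
all integer partitions, with nonnegative coefficients. -/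
def IsEPositive {V : Type*} [Fintype V] (G : SimpleGraph V) : Prop :=
  ∃ c : (Σ d : ℕ, d.Partition) →₀ ℚ,
    (∀ μ, 0 ≤ c μ) ∧ chromaticSymmetricFunction G = c.sum fun μ a => a • elemSymmPart μ.2

end

/-!
# Sun graphs without connected partitions

*Connected partitions.* A connected set of vertices of a sun graph that has more vertices than any
arm meets two arms, and therefore contains the body vertex of every arm that it meets
(`mem_of_induce_connected`). As the parts of a partition are disjoint, each arm lies in a single
part, so that the size of each part is a sum of numbers `l i + 1` and hence divisible by their
greatest common divisor `g`. But `g` divides `l 0 + 1` and so does not divide `l 0 + 2`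
(`not_hasConnectedPartition_attachRays`).

*e-positivity.* It remains to see that a connected e-positive graph `G` with `N = a + b` vertices
has a connected partition of type `(a, b)` (`IsEPositive.hasConnectedPartition_pair`). Instead of
the expansion of `X_G` in power sums, specializations of the variables are used. The negatives of
the `m`-th roots of `-1` satisfy `∏ j, (1 + x j * t) = 1 + t ^ m` (`exists_weights`). Replacing the
variables by these numbers for `m = N`, each times `A`, turns `e_N` into `A ^ N` and all other `e_i`
with `i > 0` into `0`. Replacing them by these numbers for `m = a`, times `A`, together with those
for `m = b`, times `B`, turns the sum of the `e_i` into `(1 + A ^ a) * (1 + B ^ b)`. Hence for all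
`μ` the coefficient of `e_μ` at `A ^ N` in the first specialization is at most its coefficient at
`A ^ a * B ^ b` in the second (`coeff_specialize_elemSymmPart_le`), and for an e-positive graph this
inequality carries over to `X_G`.

The coefficient of `X_G` in the first specialization is a sum over proper colourings weighted by
roots of unity. Deletion and contraction of edges, applied to colourings of a fixed vertex set that
are constant along some edges and proper along others, shows that it is positive if `G` is connected
(`sum_coloring_pos`). The coefficient in the second specialization is a sum over the sets `W` of `a`
vertices, where the vertices in `W` get the colours of the first type. If `W` or its complement does
not induce a connected subgraph, then multiplying the colours on one of its components by a root of
unity shows that the contribution of `W` is zero (`sum_prod_eq_zero_of_rotation`,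
`induce_connected_of_sum_ne_zero`). As the whole sum is positive, some `W` and its complement both
induce connected subgraphs.
-/

open Finset
open scoped ComplexOrder

/-! ### Sums of weighted colourings and rotations of the colours -/

/-- If the colours of the vertices in `C` can be permuted by `σ` without leaving the class `P` of
colourings, and `σ` multiplies their weights by `ζ`, then the weighted sum over `P` is multiplied
by `ζ ^ #C`, so that it vanishes unless `ζ ^ #C = 1`. -/
theorem sum_prod_eq_zero_of_rotation {V ι R : Type*} [Fintype V] [DecidableEq V] [Fintype ι]
    [CommRing R] [IsDomain R] (P : (V → ι) → Prop) [DecidablePred P] (y : ι → R)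
    (ζ : R) (σ : Equiv.Perm ι) (C : Finset V)
    (hP : ∀ k, P k → P (fun v => if v ∈ C then σ (k v) else k v))
    (hy : ∀ k, P k → ∀ v ∈ C, y (σ (k v)) = ζ * y (k v)) (hζ : ζ ^ #C ≠ 1) :
    ∑ k with P k, ∏ v, y (k v) = 0 := by
  let e : (V → ι) ↪ (V → ι) :=
    ⟨fun k v => if v ∈ C then σ (k v) else k v, by
      intro k k' h
      funext v
      have := congrFun h v
      by_cases hv : v ∈ C
      · simpa [hv] using this
      · simpa [hv] using this⟩
  have hmap : (univ.filter P).map e = univ.filter P := by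
    apply eq_of_subset_of_card_le
    · intro k hk
      obtain ⟨k', hk', rfl⟩ := mem_map.1 hk
      exact mem_filter.2 ⟨mem_univ _, hP k' (mem_filter.1 hk').2⟩
    · rw [card_map]
  have key : ∑ k with P k, ∏ v, y (k v) = ζ ^ #C * ∑ k with P k, ∏ v, y (k v) := by
    conv_lhs => rw [← hmap, sum_map]
    rw [mul_sum]
    refine sum_congr rfl fun k hk => ?_
    have h1 : ∀ v, y (e k v) = (if v ∈ C then ζ else 1) * y (k v) := by
      intro v
      by_cases hv : v ∈ C
      · rw [show e k v = σ (k v) from if_pos hv, if_pos hv, hy k (mem_filter.1 hk).2 v hv]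
      · rw [show e k v = k v from if_neg hv, if_neg hv, one_mul]
    simp only [h1, prod_mul_distrib]
    simp
  have h2 : (ζ ^ #C - 1) * ∑ k with P k, ∏ v, y (k v) = 0 := by
    rw [sub_mul, ← key, one_mul, sub_self]
  exact (mul_eq_zero.1 h2).resolve_left (sub_ne_zero.2 hζ)

/-- A graph that is not preconnected has a union of connected components that is neither empty nor
everything. -/
theorem SimpleGraph.exists_closed_of_not_preconnected {V : Type*} {G : SimpleGraph V}
    (h : ¬ G.Preconnected) :
    ∃ C : Set V, C.Nonempty ∧ (∃ v, v ∉ C) ∧ ∀ u v, G.Adj u v → (u ∈ C ↔ v ∈ C) := by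
  unfold SimpleGraph.Preconnected at h
  push Not at h
  obtain ⟨u, v, huv⟩ := h
  refine ⟨{w | G.Reachable u w}, ⟨u, SimpleGraph.Reachable.refl u⟩, ⟨v, huv⟩, fun a b hab => ?_⟩
  exact ⟨fun h => h.trans hab.reachable, fun h => h.trans hab.symm.reachable⟩

/-- Reachability in a graph with one more edge. -/
theorem SimpleGraph.Reachable.of_sup_edge {V : Type*} {G : SimpleGraph V} {x y u v : V}
    (h : (G ⊔ SimpleGraph.edge x y).Reachable u v) :
    G.Reachable u v ∨ (G.Reachable u x ∧ G.Reachable y v) ∨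
      (G.Reachable u y ∧ G.Reachable x v) := by
  obtain ⟨p⟩ := h
  induction p with
  | nil => exact Or.inl (SimpleGraph.Reachable.refl _)
  | @cons a b c hab p ih =>
    have hab' : G.Reachable a b ∨ (a = x ∧ b = y) ∨ (a = y ∧ b = x) := by
      rw [SimpleGraph.sup_adj, SimpleGraph.edge_adj] at hab
      rcases hab with h | ⟨h, _⟩
      · exact Or.inl h.reachable
      · exact Or.inr h
    have hr := fun w : V => SimpleGraph.Reachable.refl (G := G) w
    rcases hab' with h | ⟨rfl, rfl⟩ | ⟨rfl, rfl⟩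
    · rcases ih with h1 | ⟨h1, h2⟩ | ⟨h1, h2⟩
      · exact Or.inl (h.trans h1)
      · exact Or.inr (Or.inl ⟨h.trans h1, h2⟩)
      · exact Or.inr (Or.inr ⟨h.trans h1, h2⟩)
    · rcases ih with h1 | ⟨h1, h2⟩ | ⟨h1, h2⟩
      · exact Or.inr (Or.inl ⟨hr _, h1⟩)
      · exact Or.inr (Or.inl ⟨hr _, h2⟩)
      · exact Or.inl h2
    · rcases ih with h1 | ⟨h1, h2⟩ | ⟨h1, h2⟩
      · exact Or.inr (Or.inr ⟨hr _, h1⟩)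
      · exact Or.inl h2
      · exact Or.inr (Or.inr ⟨hr _, h2⟩)

/-! ### Deletion and contraction -/

section DeletionContraction

open Classical

variable {V ι : Type*}

/-- The graph whose edges are the non-diagonal pairs in `E`. -/
def pairGraph (E : Finset (V × V)) : SimpleGraph V := SimpleGraph.fromRel fun u v => (u, v) ∈ E

theorem pairGraph_insert (E : Finset (V × V)) (p : V × V) :
    pairGraph (insert p E) = pairGraph E ⊔ SimpleGraph.edge p.1 p.2 := by
  ext u v
  obtain ⟨a, b⟩ := p
  simp only [pairGraph, SimpleGraph.fromRel_adj, mem_insert, Prod.mk.injEq, SimpleGraph.sup_adj,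
    SimpleGraph.edge_adj]
  tauto

theorem apply_eq_of_reachable {T : SimpleGraph V} {k : V → ι}
    (hk : ∀ u v, T.Adj u v → k u = k v) {u v : V} (h : T.Reachable u v) : k u = k v := by
  obtain ⟨p⟩ := h
  induction p with
  | nil => rfl
  | cons h _ ih => exact (hk _ _ h).trans ih

variable [Fintype V] [Fintype ι]

/-- The sum of the weights `∏ v, y (k v)` over all `k : V → ι` that are constant along the edges
of `T` and take different values at the two ends of each pair in `E`. The edges of `T` are thought
of as contracted, those in `E` as the edges that are left. -/
noncomputable def constrainedSum (y : ι → ℂ) (T : SimpleGraph V) (E : Finset (V × V)) : ℂ :=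
  ∑ k : V → ι with (∀ u v, T.Adj u v → k u = k v) ∧ ∀ p ∈ E, k p.1 ≠ k p.2, ∏ v, y (k v)

theorem constrainedSum_insert (y : ι → ℂ) (T : SimpleGraph V) (E : Finset (V × V)) (p : V × V) :
    constrainedSum y T (insert p E) =
      constrainedSum y T E - constrainedSum y (T ⊔ SimpleGraph.edge p.1 p.2) E := by
  unfold constrainedSum
  rw [eq_sub_iff_add_eq, ← sum_filter_add_sum_filter_not
    (univ.filter fun k : V → ι => (∀ u v, T.Adj u v → k u = k v) ∧ ∀ p ∈ E, k p.1 ≠ k p.2)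
    (fun k => k p.1 = k p.2), add_comm, filter_filter, filter_filter]
  congr 2
  · ext k
    simp only [mem_filter, mem_univ, true_and, SimpleGraph.sup_adj, SimpleGraph.edge_adj]
    constructor
    · rintro ⟨h, h'⟩
      refine ⟨⟨fun u v huv => h u v (Or.inl huv), h'⟩, ?_⟩
      by_cases hp : p.1 = p.2
      · rw [hp]
      · exact h _ _ (Or.inr ⟨Or.inl ⟨rfl, rfl⟩, hp⟩)
    · rintro ⟨⟨h, h'⟩, hp⟩
      refine ⟨fun u v huv => ?_, h'⟩
      rcases huv with huv | ⟨⟨rfl, rfl⟩ | ⟨rfl, rfl⟩, _⟩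
      · exact h u v huv
      · exact hp
      · exact hp.symm
  · ext k
    simp only [mem_filter, mem_univ, true_and, mem_insert, forall_eq_or_imp]
    tauto

theorem constrainedSum_eq_zero_of_reachable (y : ι → ℂ) {T : SimpleGraph V} {E : Finset (V × V)}
    {p : V × V} (hp : p ∈ E) (h : T.Reachable p.1 p.2) : constrainedSum y T E = 0 := by
  unfold constrainedSum
  rw [filter_false_of_mem, sum_empty]
  rintro k - ⟨h1, h2⟩
  exact h2 p hp (apply_eq_of_reachable h1 h)

variable {y : ι → ℂ} {σ : Equiv.Perm ι} {ζ : ℂ}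

theorem constrainedSum_eq_zero_of_not_connected [Nonempty V]
    (hζ : IsPrimitiveRoot ζ (Fintype.card V))
    (hσ : ∀ j, y (σ j) = ζ * y j) {T : SimpleGraph V} (hT : ¬ T.Connected) :
    constrainedSum y T ∅ = 0 := by
  have hT' : ¬ T.Preconnected := fun h => hT ⟨h⟩
  obtain ⟨C, ⟨u, hu⟩, ⟨v, hv⟩, hC⟩ := SimpleGraph.exists_closed_of_not_preconnected hT'
  refine sum_prod_eq_zero_of_rotation _ y ζ σ C.toFinset ?_ (fun k _ v _ => hσ _) ?_
  · rintro k ⟨hk, -⟩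
    refine ⟨fun a b hab => ?_, by simp⟩
    have := hC a b hab
    by_cases ha : a ∈ C
    · simp [ha, this.1 ha, hk a b hab]
    · simp [ha, mt this.2 ha, hk a b hab]
  · apply hζ.pow_ne_one_of_pos_of_lt
    · exact (card_pos.2 ⟨u, by simpa using hu⟩).ne'
    · exact card_lt_univ_of_notMem (x := v) (by simpa using hv)

theorem constrainedSum_of_isTree (hy : ∀ j, y j ^ Fintype.card V = (-1) ^ (Fintype.card V - 1))
    {T : SimpleGraph V} (hT : T.IsTree) :
    (-1) ^ T.edgeSet.ncard * constrainedSum y T ∅ = Fintype.card ι := by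
  have := hT.card_edgeFinset
  rw [← Set.ncard_coe_finset, SimpleGraph.coe_edgeFinset] at this
  obtain ⟨v₀⟩ := hT.connected.nonempty
  have h : constrainedSum y T ∅ = ∑ j : ι, y j ^ Fintype.card V := by
    unfold constrainedSum
    symm
    refine sum_bij (fun j _ => fun _ => j) (by simp) ?_ ?_ (by simp [card_univ])
    · intro a _ b _ hab
      exact congrFun hab v₀
    · intro k hk
      refine ⟨k v₀, mem_univ _, funext fun v => ?_⟩
      exact apply_eq_of_reachable (mem_filter.1 hk).2.1 (hT.connected.preconnected v₀ v)
  simp only [h, hy, sum_const, card_univ, nsmul_eq_mul]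
  rw [← this, Nat.add_sub_cancel, mul_left_comm, ← mul_pow]
  simp

theorem card_edgeFinset_sup_edge_of_not_reachable {T : SimpleGraph V} {u v : V}
    (h : ¬ T.Reachable u v) : (T ⊔ SimpleGraph.edge u v).edgeSet.ncard = T.edgeSet.ncard + 1 := by
  have h1 : ¬ T.Adj u v := fun h' => h h'.reachable
  have h2 : u ≠ v := by
    rintro rfl
    exact h (SimpleGraph.Reachable.refl _)
  have := SimpleGraph.card_edgeFinset_sup_edge T h1 h2
  rwa [← Set.ncard_coe_finset, ← Set.ncard_coe_finset, SimpleGraph.coe_edgeFinset,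
    SimpleGraph.coe_edgeFinset] at this

/-- The deletion-contraction recurrence with the sign that makes both of its terms nonnegative. -/
theorem signed_constrainedSum_insert (y : ι → ℂ) {T : SimpleGraph V} (E : Finset (V × V))
    {p : V × V} (h : ¬ T.Reachable p.1 p.2) :
    (-1) ^ T.edgeSet.ncard * constrainedSum y T (insert p E) =
      (-1) ^ T.edgeSet.ncard * constrainedSum y T E +
      (-1) ^ (T ⊔ SimpleGraph.edge p.1 p.2).edgeSet.ncard *
        constrainedSum y (T ⊔ SimpleGraph.edge p.1 p.2) E := by
  rw [constrainedSum_insert, card_edgeFinset_sup_edge_of_not_reachable h]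
  ring

/-- Contracting one more edge outside the forest `T` changes the sign, and the deletion-contraction
recurrence ends with spanning trees (each contributing the number of colours) and with disconnected
forests (contributing nothing). -/
theorem signed_constrainedSum_nonneg [Nonempty V] (hζ : IsPrimitiveRoot ζ (Fintype.card V))
    (hσ : ∀ j, y (σ j) = ζ * y j) (hy : ∀ j, y j ^ Fintype.card V = (-1) ^ (Fintype.card V - 1))
    (E : Finset (V × V)) : ∀ T : SimpleGraph V, T.IsAcyclic →
      0 ≤ (-1) ^ T.edgeSet.ncard * constrainedSum y T E := by
  induction E using Finset.induction with
  | empty =>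
    intro T hT
    by_cases hc : T.Connected
    · rw [constrainedSum_of_isTree hy ⟨hc, hT⟩]
      exact Nat.cast_nonneg _
    · rw [constrainedSum_eq_zero_of_not_connected hζ hσ hc, mul_zero]
  | insert p E _ ih =>
    intro T hT
    by_cases hp : T.Reachable p.1 p.2
    · rw [constrainedSum_eq_zero_of_reachable y (mem_insert_self p E) hp, mul_zero]
    · rw [signed_constrainedSum_insert y E hp]
      exact add_nonneg (ih T hT) (ih _ (hT.sup_edge_of_not_reachable hp))

/-- Some term of the recurrence survives if the graph is connected: an edge is deleted if the rest
stays connected, and contracted otherwise. The condition that no remaining pair is a loop is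
preserved. -/
theorem signed_constrainedSum_pos [Nonempty V] [Nonempty ι]
    (hζ : IsPrimitiveRoot ζ (Fintype.card V))
    (hσ : ∀ j, y (σ j) = ζ * y j) (hy : ∀ j, y j ^ Fintype.card V = (-1) ^ (Fintype.card V - 1))
    (E : Finset (V × V)) : ∀ T : SimpleGraph V, T.IsAcyclic → (T ⊔ pairGraph E).Connected →
      (∀ p ∈ E, ¬ T.Reachable p.1 p.2) → 0 < (-1) ^ T.edgeSet.ncard * constrainedSum y T E := by
  induction E using Finset.induction with
  | empty =>
    intro T hT hc _
    have hc' : T.Connected := by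
      convert hc
      ext u v
      simp [pairGraph]
    rw [constrainedSum_of_isTree hy ⟨hc', hT⟩]
    exact_mod_cast Fintype.card_pos
  | insert p E _ ih =>
    intro T hT hc hE
    have hp := hE p (mem_insert_self p E)
    have hT' := hT.sup_edge_of_not_reachable hp
    rw [signed_constrainedSum_insert y E hp]
    by_cases hc' : (T ⊔ pairGraph E).Connected
    · exact add_pos_of_pos_of_nonneg
        (ih T hT hc' fun q hq => hE q (mem_insert_of_mem hq))
        (signed_constrainedSum_nonneg hζ hσ hy E _ hT')
    · refine add_pos_of_nonneg_of_pos (signed_constrainedSum_nonneg hζ hσ hy E _ hT)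
        (ih _ hT' ?_ fun q hq hreach => hc' ?_)
      · rwa [sup_right_comm, sup_assoc, ← pairGraph_insert]
      -- A pair of `E` that becomes a loop after the contraction of `p` joins the two ends of `p`
      -- by another route, so that `p` is not needed for connectedness.
      · have hq' := hE q (mem_insert_of_mem hq)
        have hne : q.1 ≠ q.2 := by
          intro h
          rw [h] at hq'
          exact hq' (SimpleGraph.Reachable.refl _)
        have hadj : (T ⊔ pairGraph E).Reachable q.1 q.2 :=
          SimpleGraph.Adj.reachable (Or.inr ((SimpleGraph.fromRel_adj _ _ _).2 ⟨hne, Or.inl hq⟩))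
        have hmono : ∀ {a b}, T.Reachable a b → (T ⊔ pairGraph E).Reachable a b :=
          fun h => h.mono le_sup_left
        have hpp : (T ⊔ pairGraph E).Reachable p.1 p.2 := by
          rcases hreach.of_sup_edge with h | ⟨h1, h2⟩ | ⟨h1, h2⟩
          · exact absurd h hq'
          · exact (hmono h1.symm).trans (hadj.trans (hmono h2.symm))
          · exact (hmono h2).trans (hadj.symm.trans (hmono h1))
        refine ⟨fun u v => ?_⟩
        have huv := hc.preconnected u v
        rw [pairGraph_insert, ← sup_assoc] at huv
        rcases huv.of_sup_edge with h | ⟨h1, h2⟩ | ⟨h1, h2⟩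
        · exact h
        · exact h1.trans (hpp.trans h2)
        · exact h1.trans (hpp.symm.trans h2)

/-- The value of the chromatic symmetric function of a connected graph at the weights `y` is
positive. Up to sign and normalization it is the coefficient of the power sum `p_{|V|}`. -/
theorem sum_coloring_pos [Nonempty ι] {G : SimpleGraph V} (hG : G.Connected)
    (hζ : IsPrimitiveRoot ζ (Fintype.card V)) (hσ : ∀ j, y (σ j) = ζ * y j)
    (hy : ∀ j, y j ^ Fintype.card V = (-1) ^ (Fintype.card V - 1)) :
    0 < ∑ k : V → ι with ∀ u v, G.Adj u v → k u ≠ k v, ∏ v, y (k v) := by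
  have := hG.nonempty
  let E : Finset (V × V) := univ.filter fun p => G.Adj p.1 p.2
  have hE : pairGraph E = G := by
    ext u v
    simp only [pairGraph, SimpleGraph.fromRel_adj, E, mem_filter, mem_univ, true_and]
    exact ⟨fun h => h.2.elim id fun h => h.symm, fun h => ⟨h.ne, Or.inl h⟩⟩
  have h := signed_constrainedSum_pos hζ hσ hy E ⊥ SimpleGraph.isAcyclic_bot
    (by rwa [hE, bot_sup_eq])
    (fun p hp h => (mem_filter.1 hp).2.ne (SimpleGraph.reachable_bot.1 h))
  have h0 : (⊥ : SimpleGraph V).edgeSet.ncard = 0 := by simp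
  rw [h0, pow_zero, one_mul] at h
  convert h using 1
  unfold constrainedSum
  congr 1
  ext k
  simp [E]

end DeletionContraction

/-! ### Specializing the variables to finitely many power series -/

section Specialization

open Classical MvPowerSeries

variable {ι τ : Type*} [Fintype ι]

/-- The number of a colour, in some fixed enumeration of the finitely many colours. -/
noncomputable def colourIndex (j : ι) : ℕ := Fintype.equivFin ι j

theorem colourIndex_injective : Function.Injective (colourIndex : ι → ℕ) := fun _ _ h =>
  (Fintype.equivFin ι).injective (Fin.ext h)

theorem colourIndex_lt (j : ι) : colourIndex j < Fintype.card ι := (Fintype.equivFin ι j).2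

theorem exists_colourIndex_eq {m : ℕ} (h : m < Fintype.card ι) : ∃ j : ι, colourIndex j = m :=
  ⟨(Fintype.equivFin ι).symm ⟨m, h⟩, by simp [colourIndex]⟩

/-- The family that takes the value `y j` at the number of the colour `j`, and `0` at the natural
numbers that are not the number of a colour. -/
noncomputable def extendByZero (y : ι → MvPowerSeries τ ℂ) (m : ℕ) : MvPowerSeries τ ℂ :=
  if h : m < Fintype.card ι then y ((Fintype.equivFin ι).symm ⟨m, h⟩) else 0

theorem extendByZero_colourIndex (y : ι → MvPowerSeries τ ℂ) (j : ι) :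
    extendByZero y (colourIndex j) = y j := by
  simp [extendByZero, colourIndex]

theorem hasSubst_extendByZero {y : ι → MvPowerSeries τ ℂ} (hy : ∀ j, constantCoeff (y j) = 0) :
    HasSubst (extendByZero y) where
  const_coeff m := by
    unfold extendByZero
    split_ifs <;> simp [hy]
  coeff_zero d := by
    refine (Set.finite_lt_nat (Fintype.card ι)).subset fun m hm => ?_
    by_contra h
    simp only [Set.mem_ofPred_eq] at h hm
    simp [extendByZero, h] at hm

/-- The ring homomorphism that replaces the variables by the power series `y j`, one for each
colour `j`, and the remaining variables by `0`. -/
noncomputable def specialize (y : ι → MvPowerSeries τ ℂ) (hy : ∀ j, constantCoeff (y j) = 0) :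
    MvPowerSeries ℕ ℚ →ₐ[ℚ] MvPowerSeries τ ℂ :=
  substAlgHom (hasSubst_extendByZero hy)

variable {y : ι → MvPowerSeries τ ℂ} (hy : ∀ j, constantCoeff (y j) = 0)

theorem specialize_X (j : ι) : specialize y hy (X (colourIndex j)) = y j := by
  rw [specialize, substAlgHom_X, extendByZero_colourIndex]

/-- Only the monomials in the variables that belong to a colour matter. -/
theorem specialize_congr {f g : MvPowerSeries ℕ ℚ}
    (h : ∀ d : ℕ →₀ ℕ, (∀ m, Fintype.card ι ≤ m → d m = 0) → coeff d f = coeff d g) :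
    specialize y hy f = specialize y hy g := by
  have ha := hasSubst_extendByZero hy
  ext e
  rw [specialize, coe_substAlgHom, coeff_subst ha, coeff_subst ha]
  refine finsum_congr fun d => ?_
  by_cases hd : ∀ m, Fintype.card ι ≤ m → d m = 0
  · rw [h d hd]
  · push Not at hd
    obtain ⟨m, hm, hdm⟩ := hd
    have h0 : (d.prod fun s e => extendByZero y s ^ e) = 0 := by
      refine Finset.prod_eq_zero (Finsupp.mem_support_iff.2 hdm) ?_
      simp [extendByZero, not_lt.2 hm, hdm]
    rw [h0]
    simp

theorem prod_X_eq_monomial {α : Type*} (s : Finset α) (f : α → ℕ) :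
    ∏ a ∈ s, (X (f a) : MvPowerSeries ℕ ℚ) = monomial (∑ a ∈ s, Finsupp.single (f a) 1) 1 := by
  induction s using Finset.induction with
  | empty => simp
  | insert a s ha ih => rw [prod_insert ha, sum_insert ha, ih, X, monomial_mul_monomial, one_mul]

theorem sum_single_colourIndex_apply (s : Finset ι) (j : ι) :
    (∑ a ∈ s, Finsupp.single (colourIndex a) 1 : ℕ →₀ ℕ) (colourIndex j) =
      if j ∈ s then 1 else 0 := by
  simp [Finsupp.finsetSum_apply, Finsupp.single_apply, colourIndex_injective.eq_iff]

theorem sum_single_colourIndex_apply_of_le (s : Finset ι) {m : ℕ} (hm : Fintype.card ι ≤ m) :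
    (∑ a ∈ s, Finsupp.single (colourIndex a) 1 : ℕ →₀ ℕ) m = 0 := by
  rw [Finsupp.finsetSum_apply]
  exact sum_eq_zero fun a _ => Finsupp.single_eq_of_ne ((colourIndex_lt a).trans_le hm).ne'

theorem specialize_elemSymm (i : ℕ) :
    specialize y hy (elemSymm i) = ∑ s ∈ powersetCard i (univ : Finset ι), ∏ j ∈ s, y j := by
  have h : specialize y hy (elemSymm i) = specialize y hy
      (∑ s ∈ powersetCard i (univ : Finset ι), ∏ j ∈ s, X (colourIndex j)) := by
    apply specialize_congr
    intro d hd
    simp only [prod_X_eq_monomial, map_sum, coeff_monomial]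
    change (if (∀ j, d j ≤ 1) ∧ d.degree = i then (1 : ℚ) else 0) = _
    split_ifs with hdi
    · obtain ⟨h1, h2⟩ := hdi
      have hds : d = ∑ a ∈ univ.filter (fun j : ι => d (colourIndex j) = 1),
          Finsupp.single (colourIndex a) 1 := by
        ext m
        rcases lt_or_ge m (Fintype.card ι) with hm | hm
        · obtain ⟨j, rfl⟩ := exists_colourIndex_eq hm
          rw [sum_single_colourIndex_apply]
          have := h1 (colourIndex j)
          split_ifs with hj
          · simpa using hj
          · simp only [mem_filter, mem_univ, true_and] at hj
            omega
        · rw [sum_single_colourIndex_apply_of_le _ hm, hd m hm]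
      rw [sum_eq_single (univ.filter fun j : ι => d (colourIndex j) = 1), if_pos hds]
      · intro s _ hs
        rw [if_neg]
        rintro rfl
        apply hs
        ext j
        simp only [mem_filter, mem_univ, true_and, sum_single_colourIndex_apply]
        split_ifs with hj <;> simp [hj]
      · intro hs
        exfalso
        apply hs
        rw [mem_powersetCard]
        refine ⟨subset_univ _, ?_⟩
        have := congrArg Finsupp.degree hds
        rw [h2, map_sum] at this
        simpa using this.symm
    · symm
      refine sum_eq_zero fun s hs => if_neg ?_
      rintro rfl
      apply hdi
      constructor
      · intro m
        rcases lt_or_ge m (Fintype.card ι) with hm | hm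
        · obtain ⟨j, rfl⟩ := exists_colourIndex_eq hm
          rw [sum_single_colourIndex_apply]
          split_ifs <;> simp
        · rw [hd m hm]
          exact zero_le_one
      · rw [map_sum]
        simpa using (mem_powersetCard.1 hs).2
  simp only [h, map_sum, map_prod, specialize_X]

theorem specialize_chromaticSymmetricFunction {V : Type*} [Fintype V] (G : SimpleGraph V) :
    specialize y hy (chromaticSymmetricFunction G) =
      ∑ k : V → ι with ∀ u v, G.Adj u v → k u ≠ k v, ∏ v, y (k v) := by
  have h : specialize y hy (chromaticSymmetricFunction G) = specialize y hy
      (∑ k : V → ι with ∀ u v, G.Adj u v → k u ≠ k v, ∏ v, X (colourIndex (k v))) := by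
    apply specialize_congr
    intro d hd
    simp only [prod_X_eq_monomial, map_sum, coeff_monomial]
    change (Nat.card {k : G.Coloring ℕ // ∑ v : V, Finsupp.single (k v) 1 = d} : ℚ) = _
    have hlt : ∀ k : G.Coloring ℕ, ∑ v : V, Finsupp.single (k v) 1 = d → ∀ v,
        k v < Fintype.card ι := by
      rintro k rfl v
      by_contra hv
      have := hd _ (not_lt.1 hv)
      rw [Finsupp.finsetSum_apply, sum_eq_zero_iff] at this
      simpa using this v (mem_univ v)
    rw [sum_boole, filter_filter, ← Fintype.card_subtype, ← Nat.card_eq_fintype_card]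
    congr 1
    symm
    refine Nat.card_eq_of_bijective (fun k => ⟨⟨fun v => colourIndex (k.1 v), fun {u v} huv =>
      colourIndex_injective.ne (k.2.1 u v huv)⟩, k.2.2.symm⟩) ⟨fun k k' hkk' => ?_, ?_⟩
    · apply Subtype.ext
      funext v
      exact colourIndex_injective (congrArg (fun c => c.1 v) hkk')
    · rintro ⟨k, hk⟩
      choose k' hk' using fun v => exists_colourIndex_eq (hlt k hk v)
      refine ⟨⟨k', fun u v huv h => k.valid huv ?_, ?_⟩, ?_⟩
      · rw [← hk', ← hk', h]
      · simp only [hk', hk]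
      · apply Subtype.ext
        apply DFunLike.ext
        exact hk'
  simp only [h, map_sum, map_prod, specialize_X]

end Specialization

/-! ### Weights built from roots of unity -/

/-- The elementary symmetric polynomials as coefficients of a product. -/
theorem sum_powersetCard_prod_eq_coeff {ι R : Type*} [Fintype ι] [CommRing R] (y : ι → R) (i : ℕ) :
    ∑ s ∈ powersetCard i (univ : Finset ι), ∏ j ∈ s, y j =
      (∏ j, (1 + Polynomial.C (y j) * Polynomial.X)).coeff i := by
  have h : ∀ s : Finset ι, ∏ j ∈ s, (Polynomial.C (y j) * Polynomial.X) =
      Polynomial.C (∏ j ∈ s, y j) * Polynomial.X ^ #s := by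
    intro s
    rw [prod_mul_distrib, prod_const, map_prod]
  rw [prod_one_add, Polynomial.finsetSum_coeff]
  simp only [h, Polynomial.coeff_C_mul_X_pow]
  rw [← sum_filter]
  refine sum_congr ?_ fun _ _ => rfl
  ext s
  simp [mem_powersetCard, eq_comm]

/-- The weights are the negatives of the `m`-th roots of `-1`. They are chosen such that their
elementary symmetric polynomials vanish except for `e_0 = e_m = 1`, and that multiplication by an
`m`-th root of unity permutes them. -/
theorem exists_weights {m : ℕ} (hm : 0 < m) :
    ∃ (x : Fin m → ℂ) (σ : Equiv.Perm (Fin m)) (ζ : ℂ), IsPrimitiveRoot ζ m ∧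
      (∀ j, x (σ j) = ζ * x j) ∧ (∀ j, x j ^ m = (-1) ^ (m - 1)) ∧
      ∀ (S : Type) [CommRing S] [IsDomain S] [Algebra ℂ S] (t : S),
        ∏ j, (1 + algebraMap ℂ S (x j) * t) = 1 + t ^ m := by
  have : NeZero m := ⟨hm.ne'⟩
  obtain ⟨u, hu⟩ := IsAlgClosed.exists_pow_nat_eq (-1 : ℂ) hm
  have hζ := Complex.isPrimitiveRoot_exp m hm.ne'
  set ζ := Complex.exp (2 * Real.pi * Complex.I / m)
  refine ⟨fun j => -(ζ ^ (j : ℕ) * u), Equiv.addRight 1, ζ, hζ, fun j => ?_, fun j => ?_,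
    fun S _ _ _ t => ?_⟩
  · have : ζ ^ ((j + 1 : Fin m) : ℕ) = ζ * ζ ^ (j : ℕ) := by
      rw [Fin.val_add, ← pow_eq_pow_mod _ hζ.pow_eq_one, pow_add, Fin.val_one',
        ← pow_eq_pow_mod _ hζ.pow_eq_one, pow_one, mul_comm]
    simp only [Equiv.coe_addRight, this]
    ring
  · obtain ⟨r, rfl⟩ := Nat.exists_eq_succ_of_ne_zero hm.ne'
    rw [neg_pow, mul_pow, ← pow_mul, mul_comm (j : ℕ), pow_mul, hζ.pow_eq_one, hu]
    simp [pow_succ]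
  · have h := X_pow_sub_C_eq_prod (hζ.map_of_injective (algebraMap ℂ S).injective)
      (α := algebraMap ℂ S u * t) hm rfl
    have h' := congrArg (Polynomial.eval 1) h
    rw [mul_pow, ← map_pow, hu] at h'
    simp only [Polynomial.eval_prod, Polynomial.eval_sub, Polynomial.eval_pow, Polynomial.eval_X,
      Polynomial.eval_C, one_pow] at h'
    rw [← Fin.prod_univ_eq_prod_range (fun i => 1 - algebraMap ℂ S ζ ^ i * (algebraMap ℂ S u * t))]
      at h'
    rw [show (1 : S) + t ^ m = 1 - algebraMap ℂ S (-1) * t ^ m by simp, h']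
    refine prod_congr rfl fun j _ => ?_
    simp only [map_neg, map_mul, map_pow]
    ring

section TwoVariables

open Classical MvPowerSeries

/-- All coefficients of `f` are nonnegative. -/
def NonnegCoeffs (f : MvPowerSeries Bool ℂ) : Prop := ∀ d, 0 ≤ coeff d f

theorem NonnegCoeffs.mul {f g : MvPowerSeries Bool ℂ} (hf : NonnegCoeffs f) (hg : NonnegCoeffs g) :
    NonnegCoeffs (f * g) := fun d => by
  rw [coeff_mul]
  exact sum_nonneg fun p _ => mul_nonneg (hf _) (hg _)

theorem NonnegCoeffs.add {f g : MvPowerSeries Bool ℂ} (hf : NonnegCoeffs f) (hg : NonnegCoeffs g) :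
    NonnegCoeffs (f + g) := fun d => by
  rw [map_add]
  exact add_nonneg (hf d) (hg d)

theorem NonnegCoeffs.monomial_one (e : Bool →₀ ℕ) : NonnegCoeffs (monomial e 1) := fun d => by
  rw [coeff_monomial]
  split_ifs
  · exact zero_le_one
  · exact le_rfl

theorem NonnegCoeffs.zero : NonnegCoeffs 0 := fun d => by simp

theorem NonnegCoeffs.multiset_prod {s : Multiset (MvPowerSeries Bool ℂ)}
    (h : ∀ f ∈ s, NonnegCoeffs f) : NonnegCoeffs s.prod := by
  induction s using Multiset.induction with
  | empty => simpa using NonnegCoeffs.monomial_one 0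
  | cons f s ih =>
    rw [Multiset.prod_cons]
    exact (h f (Multiset.mem_cons_self f s)).mul
      (ih fun g hg => h g (Multiset.mem_cons_of_mem hg))

variable {ι : Type*}

/-- The power series that a colour `j` of type `t j` and weight `z j` is specialized to. -/
noncomputable def weightedVariable (t : ι → Bool) (z : ι → ℂ) (j : ι) : MvPowerSeries Bool ℂ :=
  monomial (Finsupp.single (t j) 1) (z j)

theorem constantCoeff_weightedVariable (t : ι → Bool) (z : ι → ℂ) (j : ι) :
    constantCoeff (weightedVariable t z j) = 0 := by
  rw [← coeff_zero_eq_constantCoeff_apply, weightedVariable, coeff_monomial, if_neg]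
  intro h
  simpa using congrArg (fun d : Bool →₀ ℕ => d (t j)) h

theorem weightedVariable_eq (t : ι → Bool) (z : ι → ℂ) (j : ι) :
    weightedVariable t z j =
      algebraMap ℂ (MvPowerSeries Bool ℂ) (z j) * monomial (Finsupp.single (t j) 1) 1 := by
  rw [← Algebra.smul_def, weightedVariable, ← map_smul, smul_eq_mul, mul_one]

theorem coeff_specialize_chromaticSymmetricFunction [Fintype ι] {V : Type*} [Fintype V]
    (G : SimpleGraph V) (t : ι → Bool) (z : ι → ℂ) (d : Bool →₀ ℕ) :
    coeff d (specialize (weightedVariable t z) (constantCoeff_weightedVariable t z)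
      (chromaticSymmetricFunction G)) =
    ∑ k : V → ι with (∀ u v, G.Adj u v → k u ≠ k v) ∧ ∑ v, Finsupp.single (t (k v)) 1 = d,
      ∏ v, z (k v) := by
  have h : ∀ (k : V → ι) (s : Finset V), ∏ v ∈ s, weightedVariable t z (k v) =
      monomial (∑ v ∈ s, Finsupp.single (t (k v)) 1) (∏ v ∈ s, z (k v)) := by
    intro k s
    induction s using Finset.induction with
    | empty => simp
    | insert a s ha ih =>
      rw [prod_insert ha, sum_insert ha, prod_insert ha, ih, weightedVariable,
        monomial_mul_monomial]
  rw [specialize_chromaticSymmetricFunction, map_sum]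
  simp only [h, coeff_monomial]
  rw [← sum_filter, filter_filter]
  simp only [eq_comm]

theorem coeff_one_add_C_mul_X_pow {R : Type*} [CommRing R] (x : R) {m i : ℕ} (hi : i ≠ 0) :
    (1 + (Polynomial.C x * Polynomial.X) ^ m : Polynomial R).coeff i =
      if i = m then x ^ m else 0 := by
  rw [mul_pow, ← Polynomial.C_pow, Polynomial.coeff_add, Polynomial.coeff_C_mul_X_pow,
    Polynomial.coeff_one, if_neg hi, zero_add]

theorem coeff_one_add_mul_one_add {R : Type*} [CommRing R] (x y : R) {a b i : ℕ} (hi : i ≠ 0) :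
    ((1 + (Polynomial.C x * Polynomial.X) ^ a) *
      (1 + (Polynomial.C y * Polynomial.X) ^ b) : Polynomial R).coeff i =
      (if i = a then x ^ a else 0) + (if i = b then y ^ b else 0) +
        if i = a + b then x ^ a * y ^ b else 0 := by
  have : ((1 + (Polynomial.C x * Polynomial.X) ^ a) *
      (1 + (Polynomial.C y * Polynomial.X) ^ b) : Polynomial R) =
      1 + Polynomial.C (x ^ a) * Polynomial.X ^ a + Polynomial.C (y ^ b) * Polynomial.X ^ b +
        Polynomial.C (x ^ a * y ^ b) * Polynomial.X ^ (a + b) := by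
    simp only [map_mul, map_pow]
    ring
  rw [this]
  simp only [Polynomial.coeff_add, Polynomial.coeff_C_mul_X_pow, Polynomial.coeff_one, if_neg hi,
    zero_add]

/-- The monomial `A ^ n` (for `true`) or `B ^ n` (for `false`). -/
theorem monomial_single_pow (c : Bool) (n : ℕ) :
    (monomial (Finsupp.single c 1) 1 : MvPowerSeries Bool ℂ) ^ n =
      monomial (Finsupp.single c n) 1 := by
  rw [monomial_pow]
  simp

theorem specialize_elemSymm_one {m : ℕ} {x : Fin m → ℂ}
    (hx : ∀ (S : Type) [CommRing S] [IsDomain S] [Algebra ℂ S] (t : S),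
        ∏ j, (1 + algebraMap ℂ S (x j) * t) = 1 + t ^ m) {i : ℕ} (hi : i ≠ 0) :
    specialize (weightedVariable (fun _ => true) x) (constantCoeff_weightedVariable _ x)
      (elemSymm i) = if i = m then monomial (Finsupp.single true m) 1 else 0 := by
  rw [specialize_elemSymm, sum_powersetCard_prod_eq_coeff]
  have := NoZeroDivisors.to_isDomain (MvPowerSeries Bool ℂ)
  have h := hx (Polynomial (MvPowerSeries Bool ℂ))
    (Polynomial.C (monomial (Finsupp.single true 1) 1) * Polynomial.X)
  simp only [Polynomial.algebraMap_apply, ← mul_assoc, ← Polynomial.C_mul,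
    ← weightedVariable_eq (fun _ => true) x] at h
  rw [h, coeff_one_add_C_mul_X_pow _ hi, monomial_single_pow]

theorem specialize_elemSymm_two {a b : ℕ} {x : Fin a → ℂ} {x' : Fin b → ℂ}
    (hx : ∀ (S : Type) [CommRing S] [IsDomain S] [Algebra ℂ S] (t : S),
        ∏ j, (1 + algebraMap ℂ S (x j) * t) = 1 + t ^ a)
    (hx' : ∀ (S : Type) [CommRing S] [IsDomain S] [Algebra ℂ S] (t : S),
        ∏ j, (1 + algebraMap ℂ S (x' j) * t) = 1 + t ^ b) {i : ℕ} (hi : i ≠ 0) :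
    specialize (weightedVariable Sum.isLeft (Sum.elim x x'))
      (constantCoeff_weightedVariable _ _) (elemSymm i) =
      (if i = a then monomial (Finsupp.single true a) 1 else 0) +
      (if i = b then monomial (Finsupp.single false b) 1 else 0) +
      if i = a + b then monomial (Finsupp.single true a + Finsupp.single false b) 1 else 0 := by
  rw [specialize_elemSymm, sum_powersetCard_prod_eq_coeff, Fintype.prod_sum_type]
  have := NoZeroDivisors.to_isDomain (MvPowerSeries Bool ℂ)
  have h := hx (Polynomial (MvPowerSeries Bool ℂ))
    (Polynomial.C (monomial (Finsupp.single true 1) 1) * Polynomial.X)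
  have h' := hx' (Polynomial (MvPowerSeries Bool ℂ))
    (Polynomial.C (monomial (Finsupp.single false 1) 1) * Polynomial.X)
  simp only [Polynomial.algebraMap_apply, ← mul_assoc, ← Polynomial.C_mul] at h h'
  simp only [weightedVariable_eq, Sum.isLeft_inl, Sum.isLeft_inr, Sum.elim_inl, Sum.elim_inr]
  rw [h, h', coeff_one_add_mul_one_add _ _ hi, monomial_single_pow, monomial_single_pow,
    monomial_mul_monomial, one_mul]

end TwoVariables

/-! ### Connected partitions with two parts of e-positive graphs -/

section Wolfgang

open Classical MvPowerSeries

/-- Among the `e_μ`, only `e_N` has a nonzero coefficient at `A ^ N` when the variables are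
specialized to `N` weights of one type, and the coefficients at `A ^ a * B ^ b` for two types of
weights are nonnegative and at least as large. -/
theorem coeff_specialize_elemSymmPart_le {a b : ℕ} (ha : 0 < a) (hb : 0 < b)
    {z : Fin (a + b) → ℂ} {x : Fin a → ℂ} {x' : Fin b → ℂ}
    (hz : ∀ (S : Type) [CommRing S] [IsDomain S] [Algebra ℂ S] (t : S),
        ∏ j, (1 + algebraMap ℂ S (z j) * t) = 1 + t ^ (a + b))
    (hx : ∀ (S : Type) [CommRing S] [IsDomain S] [Algebra ℂ S] (t : S),
        ∏ j, (1 + algebraMap ℂ S (x j) * t) = 1 + t ^ a)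
    (hx' : ∀ (S : Type) [CommRing S] [IsDomain S] [Algebra ℂ S] (t : S),
        ∏ j, (1 + algebraMap ℂ S (x' j) * t) = 1 + t ^ b) {d : ℕ} (μ : d.Partition) :
    coeff (Finsupp.single true (a + b))
      (specialize (weightedVariable (fun _ => true) z) (constantCoeff_weightedVariable _ z)
        (elemSymmPart μ)) ≤
    coeff (Finsupp.single true a + Finsupp.single false b)
      (specialize (weightedVariable Sum.isLeft (Sum.elim x x'))
        (constantCoeff_weightedVariable _ _) (elemSymmPart μ)) := by
  unfold elemSymmPart
  simp only [map_multiset_prod, Multiset.map_map, Function.comp_def]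
  have hpos : ∀ i ∈ μ.parts, i ≠ 0 := fun i hi => (μ.parts_pos hi).ne'
  rw [Multiset.map_congr rfl fun i hi => specialize_elemSymm_one hz (hpos i hi),
    Multiset.map_congr rfl fun i hi => specialize_elemSymm_two hx hx' (hpos i hi)]
  by_cases hμ : μ.parts = {a + b}
  · have h1 : a + b ≠ a := by omega
    have h2 : a + b ≠ b := by omega
    simp [hμ, ha.ne', hb.ne']
  · have h0 : coeff (Finsupp.single true (a + b)) (μ.parts.map fun i => if i = a + b then
        (monomial (Finsupp.single true (a + b)) 1 : MvPowerSeries Bool ℂ) else 0).prod = 0 := by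
      by_cases hall : ∀ i ∈ μ.parts, i = a + b
      · rw [Multiset.map_congr rfl fun i hi => if_pos (hall i hi), Multiset.map_const',
          Multiset.prod_replicate, monomial_pow, coeff_monomial, if_neg]
        intro h
        have h := congrArg (fun e : Bool →₀ ℕ => e true) h
        simp only [Finsupp.single_eq_same, Finsupp.smul_apply, smul_eq_mul] at h
        have hc : μ.parts.card = 1 :=
          Nat.eq_of_mul_eq_mul_right (by omega : 0 < a + b) (by omega)
        obtain ⟨i, hi⟩ := Multiset.card_eq_one.1 hc
        apply hμ
        rw [hi, hall i (by simp [hi])]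
      · push Not at hall
        obtain ⟨i, hi, hne⟩ := hall
        rw [Multiset.prod_eq_zero (Multiset.mem_map.2 ⟨i, hi, if_neg hne⟩), map_zero]
    rw [h0]
    refine NonnegCoeffs.multiset_prod (fun f hf => ?_) _
    obtain ⟨i, -, rfl⟩ := Multiset.mem_map.1 hf
    have hite : ∀ (p : Prop) [Decidable p] (e : Bool →₀ ℕ),
        NonnegCoeffs (if p then monomial e 1 else 0) := by
      intro p _ e
      split_ifs
      · exact NonnegCoeffs.monomial_one e
      · exact NonnegCoeffs.zero
    exact ((hite _ _).add (hite _ _)).add (hite _ _)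

/-- If the weighted colourings of `G` with a prescribed type of colour at each vertex do not cancel,
then the vertices of type `s` induce a connected subgraph. -/
theorem induce_connected_of_sum_ne_zero {V ι : Type*} [Fintype V] [Fintype ι] {G : SimpleGraph V}
    (t : ι → Bool) (z : ι → ℂ) (q : V → Bool) (s : Bool) (σ : Equiv.Perm ι) (ζ : ℂ)
    (ht : ∀ j, t (σ j) = t j) (hσ : ∀ j, t j = s → z (σ j) = ζ * z j)
    (hζ : IsPrimitiveRoot ζ #{v | q v = s}) (hq : ∃ v, q v = s)
    (h : ∑ k : V → ι with (∀ u v, G.Adj u v → k u ≠ k v) ∧ ∀ v, t (k v) = q v,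
      ∏ v, z (k v) ≠ 0) :
    (G.induce {v | q v = s}).Connected := by
  obtain ⟨v₀, hv₀⟩ := hq
  have : Nonempty {v | q v = s} := ⟨⟨v₀, hv₀⟩⟩
  refine ⟨?_⟩
  by_contra hc
  obtain ⟨C, ⟨⟨u, hus⟩, hu⟩, ⟨⟨v, hvs⟩, hv⟩, hC⟩ :=
    SimpleGraph.exists_closed_of_not_preconnected hc
  let D : Finset V := univ.filter fun w => ∃ hw : q w = s, (⟨w, hw⟩ : {v | q v = s}) ∈ C
  have hD : ∀ w, w ∈ D ↔ ∃ hw : q w = s, (⟨w, hw⟩ : {v | q v = s}) ∈ C := by simp [D]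
  have hDs : ∀ w ∈ D, q w = s := fun w hw => ((hD w).1 hw).1
  have hcross : ∀ a b, G.Adj a b → a ∈ D → b ∉ D → q b ≠ s := by
    intro a b hab ha hb hqb
    obtain ⟨hqa, ha⟩ := (hD a).1 ha
    exact hb ((hD b).2 ⟨hqb, (hC ⟨a, hqa⟩ ⟨b, hqb⟩ hab).1 ha⟩)
  refine h (sum_prod_eq_zero_of_rotation _ z ζ σ D ?_ ?_ ?_)
  · rintro k ⟨hk, hkt⟩
    constructor
    · intro a b hab
      by_cases ha : a ∈ D <;> by_cases hb : b ∈ D <;> simp only [ha, hb, if_true, if_false]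
      · exact σ.injective.ne (hk a b hab)
      · intro he
        apply hcross a b hab ha hb
        rw [← hkt, ← he, ht, hkt, hDs a ha]
      · intro he
        apply hcross b a hab.symm hb ha
        rw [← hkt, he, ht, hkt, hDs b hb]
      · exact hk a b hab
    · intro a
      by_cases ha : a ∈ D
      · simp [ha, ht, hkt]
      · simp [ha, hkt]
  · rintro k ⟨-, hkt⟩ a ha
    exact hσ _ ((hkt a).trans (hDs a ha))
  · apply hζ.pow_ne_one_of_pos_of_lt
    · exact (card_pos.2 ⟨u, (hD u).2 ⟨hus, hu⟩⟩).ne'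
    · refine card_lt_card ((ssubset_iff_of_subset fun w hw => ?_).2 ⟨v, ?_, ?_⟩)
      · simpa using hDs w hw
      · simpa using hvs
      · intro hvD
        exact hv ((hD v).1 hvD).2

theorem hasConnectedPartition_pair {V : Type*} [Fintype V] [DecidableEq V] {G : SimpleGraph V}
    (W : Finset V) (h : (G.induce (W : Set V)).Connected)
    (h' : (G.induce ((Wᶜ : Finset V) : Set V)).Connected) :
    HasConnectedPartition G {#W, #Wᶜ} := by
  have hW : W.Nonempty := by
    obtain ⟨v, hv⟩ := h.nonempty
    exact ⟨v, hv⟩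
  have hW' : Wᶜ.Nonempty := by
    obtain ⟨v, hv⟩ := h'.nonempty
    exact ⟨v, hv⟩
  have hne : W ≠ Wᶜ := fun he => by
    obtain ⟨v, hv⟩ := hW
    exact (mem_compl.1 (he ▸ hv)) hv
  refine ⟨⟨{W, Wᶜ}, ?_, ?_, ?_⟩, ?_, ?_⟩
  · rw [Finset.supIndep_pair hne]
    exact disjoint_compl_right
  · simp
  · simp only [mem_insert, mem_singleton, bot_eq_empty, not_or]
    exact ⟨hW.ne_empty.symm, hW'.ne_empty.symm⟩
  · simp only [mem_insert, mem_singleton, forall_eq_or_imp, forall_eq]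
    exact ⟨h, h'⟩
  · change Multiset.map Finset.card (insert W {Wᶜ} : Finset (Finset V)).val = _
    rw [Finset.insert_val_of_notMem (by simpa using hne)]
    simp

/-- If the colourings with `a` colours of the first type and `b` colours of the second type that
use each type `a` and `b` times, respectively, do not cancel, then there is a connected partition
of type `(a, b)`. -/
theorem hasConnectedPartition_of_sum_ne_zero {V : Type*} [Fintype V] [DecidableEq V]
    {G : SimpleGraph V} {a b : ℕ} (ha : 0 < a) (hb : 0 < b) {x : Fin a → ℂ} {x' : Fin b → ℂ}
    {σ : Equiv.Perm (Fin a)} {σ' : Equiv.Perm (Fin b)} {ζ ζ' : ℂ} (hζ : IsPrimitiveRoot ζ a)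
    (hζ' : IsPrimitiveRoot ζ' b) (hσ : ∀ j, x (σ j) = ζ * x j) (hσ' : ∀ j, x' (σ' j) = ζ' * x' j)
    (hne : ∑ k : V → Fin a ⊕ Fin b with (∀ u v, G.Adj u v → k u ≠ k v) ∧
      ∑ v, Finsupp.single (k v).isLeft 1 = Finsupp.single true a + Finsupp.single false b,
      ∏ v, Sum.elim x x' (k v) ≠ 0) : HasConnectedPartition G {a, b} := by
  set d : Bool →₀ ℕ := Finsupp.single true a + Finsupp.single false b with hd
  -- The colourings are grouped by the set of vertices that have a colour of the first type.
  rw [← sum_fiberwise (g := fun k v => (k v).isLeft)] at hne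
  obtain ⟨q, -, hq⟩ := exists_ne_zero_of_sum_ne_zero hne
  rw [filter_filter] at hq
  obtain ⟨k, hk, -⟩ := exists_ne_zero_of_sum_ne_zero hq
  obtain ⟨⟨-, hkd⟩, hkq⟩ := (mem_filter.1 hk).2
  have hqd : ∑ v, Finsupp.single (q v) 1 = d := by rw [← hkd, ← hkq]
  have hcount : ∀ s, #{v | q v = s} = d s := by
    intro s
    rw [← hqd, Finsupp.finsetSum_apply]
    simp [Finsupp.single_apply]
  have hda : #{v | q v = true} = a := by simp [hcount, hd]
  have hdb : #{v | q v = false} = b := by simp [hcount, hd]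
  have hq' : ∑ k : V → Fin a ⊕ Fin b with (∀ u v, G.Adj u v → k u ≠ k v) ∧
      ∀ v, (k v).isLeft = q v, ∏ v, Sum.elim x x' (k v) ≠ 0 := by
    convert hq using 2
    ext k
    simp only [mem_filter, mem_univ, true_and, funext_iff]
    constructor
    · rintro ⟨h1, h2⟩
      exact ⟨⟨h1, by simp only [h2, hqd]⟩, h2⟩
    · rintro ⟨⟨h1, -⟩, h2⟩
      exact ⟨h1, h2⟩
  have hex : ∀ s, 0 < #{v | q v = s} → ∃ v, q v = s := by
    intro s hs
    obtain ⟨v, hv⟩ := card_pos.1 hs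
    exact ⟨v, (mem_filter.1 hv).2⟩
  have h1 := induce_connected_of_sum_ne_zero (G := G) Sum.isLeft (Sum.elim x x') q true
    (Equiv.sumCongr σ (Equiv.refl _)) ζ (by rintro (j | j) <;> rfl)
    (by rintro (j | j) hj; exacts [hσ j, by simp at hj]) (by rwa [hda]) (hex _ (by rwa [hda]))
    (by convert hq')
  have h2 := induce_connected_of_sum_ne_zero (G := G) Sum.isLeft (Sum.elim x x') q false
    (Equiv.sumCongr (Equiv.refl _) σ') ζ' (by rintro (j | j) <;> rfl)
    (by rintro (j | j) hj; exacts [by simp at hj, hσ' j]) (by rwa [hdb]) (hex _ (by rwa [hdb]))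
    (by convert hq')
  have hcompl : (univ.filter fun v => q v = true)ᶜ = univ.filter fun v => q v = false := by
    ext v
    simp
  have hcoe : ∀ s, ((univ.filter fun v => q v = s : Finset V) : Set V) = {v | q v = s} := by
    intro s
    ext v
    simp
  have := hasConnectedPartition_pair (G := G) (univ.filter fun v => q v = true)
    (by rwa [hcoe])
    (by rwa [hcompl, hcoe])
  rwa [hcompl, hda, hdb] at this

/-- A connected e-positive graph has a connected partition of every type with two parts. -/
theorem IsEPositive.hasConnectedPartition_pair {V : Type*} [Fintype V] [DecidableEq V]
    {G : SimpleGraph V} (hG : G.Connected) (he : IsEPositive G) {a b : ℕ} (ha : 0 < a) (hb : 0 < b)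
    (hV : Fintype.card V = a + b) : HasConnectedPartition G {a, b} := by
  obtain ⟨z, τ, ξ, hξ, hτ, hzpow, hz⟩ := exists_weights (Nat.add_pos_left ha b)
  obtain ⟨x, σ, ζ, hζ, hσ, -, hx⟩ := exists_weights ha
  obtain ⟨x', σ', ζ', hζ', hσ', -, hx'⟩ := exists_weights hb
  obtain ⟨c, hc, hXG⟩ := he
  have : Nonempty (Fin (a + b)) := ⟨⟨0, by omega⟩⟩
  have hpos := sum_coloring_pos hG (by rwa [hV]) hτ (by rwa [hV])
  have hle : coeff (Finsupp.single true (a + b))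
      (specialize (weightedVariable (fun _ => true) z) (constantCoeff_weightedVariable _ z)
        (chromaticSymmetricFunction G)) ≤
      coeff (Finsupp.single true a + Finsupp.single false b)
        (specialize (weightedVariable Sum.isLeft (Sum.elim x x'))
          (constantCoeff_weightedVariable _ _) (chromaticSymmetricFunction G)) := by
    rw [hXG]
    simp only [Finsupp.sum, map_sum, map_smul, map_rat_smul]
    refine sum_le_sum fun μ _ => ?_
    rw [Rat.smul_def, Rat.smul_def]
    exact mul_le_mul_of_nonneg_left (coeff_specialize_elemSymmPart_le ha hb hz hx hx' μ.2)
      (by rw [← Complex.ofReal_ratCast]; exact Complex.zero_le_real.2 (Rat.cast_nonneg.2 (hc μ)))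
  rw [coeff_specialize_chromaticSymmetricFunction, coeff_specialize_chromaticSymmetricFunction]
    at hle
  have hsum : ∑ v : V, Finsupp.single true 1 = (Finsupp.single true (a + b) : Bool →₀ ℕ) := by
    simp [hV]
  simp only [hsum, and_true] at hle
  refine hasConnectedPartition_of_sum_ne_zero ha hb hζ hζ' hσ hσ' ?_
  have hne := (lt_of_lt_of_le (by convert hpos) hle).ne'
  convert hne

end Wolfgang

/-! ### Sun graphs -/

section SunGraphs

variable {n : ℕ} {H : SimpleGraph (Fin n)} {l : Fin n → ℕ}

theorem attachRays_connected (hH : H.Connected) : (attachRays H l).Connected := by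
  have h0 : ∀ x : Σ i : Fin n, Fin (l i + 1), (attachRays H l).Reachable x ⟨x.1, 0⟩ := by
    rintro ⟨i, m, hm⟩
    induction m with
    | zero => exact SimpleGraph.Reachable.refl _
    | succ m ih =>
      have hadj : (attachRays H l).Adj ⟨i, m + 1, hm⟩ ⟨i, m, by omega⟩ := Or.inr ⟨rfl, Or.inr rfl⟩
      exact hadj.reachable.trans (ih (by omega))
  let f : H →g attachRays H l := ⟨fun i => ⟨i, 0⟩, fun h => Or.inl ⟨rfl, rfl, h⟩⟩
  obtain ⟨i⟩ := hH.nonempty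
  have : Nonempty (Σ i : Fin n, Fin (l i + 1)) := ⟨⟨i, 0⟩⟩
  exact ⟨fun x y => (h0 x).trans (((hH.preconnected x.1 y.1).map f).trans (h0 y).symm)⟩

/-- A connected set that meets an arm without being contained in it contains the vertex of the arm
that lies on the body. -/
theorem mem_of_induce_connected {A : Finset (Σ i : Fin n, Fin (l i + 1))}
    (hA : ((attachRays H l).induce (A : Set _)).Connected) {x y : Σ i : Fin n, Fin (l i + 1)}
    (hx : x ∈ A) (hy : y ∈ A) (hxy : y.1 ≠ x.1) : (⟨x.1, 0⟩ : Σ i : Fin n, Fin (l i + 1)) ∈ A := by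
  have key : ∀ (u v : (A : Set (Σ i : Fin n, Fin (l i + 1))))
      (_ : ((attachRays H l).induce (A : Set _)).Walk u v), v.1.1 ≠ u.1.1 →
      (⟨u.1.1, 0⟩ : Σ i : Fin n, Fin (l i + 1)) ∈ A := by
    intro u v p
    induction p with
    | nil => exact fun h => absurd rfl h
    | @cons u w v h p ih =>
      intro hne
      by_cases huw : u.1.1 = w.1.1
      · rw [huw]
        exact ih (huw ▸ hne)
      · rcases h with ⟨h0, -⟩ | ⟨h0, -⟩
        · obtain ⟨⟨i, m⟩, hu⟩ := u
          obtain rfl : m = 0 := Fin.ext h0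
          exact hu
        · exact absurd h0 huw
  obtain ⟨p⟩ := hA.preconnected ⟨x, hx⟩ ⟨y, hy⟩
  exact key _ _ p hxy

/-- If all parts have more vertices than any arm, then every part is a union of arms, so that its
size is divisible by each common divisor of the sizes of the arms. -/
theorem not_hasConnectedPartition_attachRays {c g : ℕ} (hc : ∀ i, l i + 1 < c)
    (hg : ∀ i, g ∣ l i + 1) (hgc : ¬ g ∣ c) {μ : Multiset ℕ} (hμ : ∀ m ∈ μ, c ≤ m) (hcμ : c ∈ μ) :
    ¬ HasConnectedPartition (attachRays H l) μ := by
  rintro ⟨P, hP, rfl⟩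
  have hlarge : ∀ B ∈ P.parts, ∀ x ∈ B, (⟨x.1, 0⟩ : Σ i : Fin n, Fin (l i + 1)) ∈ B := by
    intro B hB x hx
    have hex : ∃ y ∈ B, y.1 ≠ x.1 := by
      by_contra! h
      have hsub : B ⊆ ({x.1} : Finset (Fin n)).sigma fun _ => univ := fun y hy => by
        simp [h y hy]
      have h1 := card_le_card hsub
      rw [card_sigma, sum_singleton, card_univ, Fintype.card_fin] at h1
      have h2 := hμ #B (Multiset.mem_map_of_mem _ hB)
      have h3 := hc x.1
      omega
    obtain ⟨y, hy, hxy⟩ := hex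
    exact mem_of_induce_connected (hP B hB) hx hy hxy
  obtain ⟨A, hA, rfl⟩ := Multiset.mem_map.1 hcμ
  apply hgc
  have hAeq : A = (univ.filter fun i => (⟨i, 0⟩ : Σ i : Fin n, Fin (l i + 1)) ∈ A).sigma
      fun _ => univ := by
    ext x
    simp only [mem_sigma, mem_filter, mem_univ, true_and, and_true]
    refine ⟨hlarge A hA x, fun hx => ?_⟩
    obtain ⟨B, hB, hxB⟩ := P.exists_mem (mem_univ x)
    rwa [P.eq_of_mem_parts hA hB hx (hlarge B hB x hxB)]
  rw [hAeq, card_sigma]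
  refine dvd_sum fun i _ => ?_
  rw [card_univ, Fintype.card_fin]
  exact hg i

end SunGraphs

theorem mainTheorem2 (n : ℕ) [NeZero n] (hn : 3 ≤ n) (l : Fin n → ℕ)
    (hmax : ∀ i, l i ≤ l 0)
    (hgcd : 1 < Finset.univ.gcd (fun i => l i + 1))
    (hle : l 0 + 2 ≤ (∑ i ∈ Finset.univ.erase 0, l i) + (n - 2)) :
    (¬ HasConnectedPartition (sunGraph l)
        {(∑ i ∈ Finset.univ.erase 0, l i) + (n - 2), l 0 + 2} ∧
      ¬ HasConnectedPartition (completeSunGraph l)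
        {(∑ i ∈ Finset.univ.erase 0, l i) + (n - 2), l 0 + 2}) ∧
    (¬ IsEPositive (sunGraph l) ∧ ¬ IsEPositive (completeSunGraph l)) := by
  set s := (∑ i ∈ Finset.univ.erase 0, l i) + (n - 2) with hs
  have hdvd : ∀ i, univ.gcd (fun i => l i + 1) ∣ l i + 1 := fun i => gcd_dvd (mem_univ i)
  have hndvd : ¬ univ.gcd (fun i => l i + 1) ∣ l 0 + 2 := fun h => by
    have := Nat.dvd_one.1 ((Nat.dvd_add_right (hdvd 0)).1 h)
    omega
  have hpart : ∀ H : SimpleGraph (Fin n), ¬ HasConnectedPartition (attachRays H l) {s, l 0 + 2} :=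
    fun H => not_hasConnectedPartition_attachRays (fun i => by have := hmax i; omega) hdvd hndvd
      (by simpa using hle) (by simp)
  have hcard : Fintype.card (Σ i : Fin n, Fin (l i + 1)) = s + (l 0 + 2) := by
    rw [Fintype.card_sigma]
    simp only [Fintype.card_fin, sum_add_distrib, sum_const, card_univ, smul_eq_mul, mul_one]
    rw [← add_sum_erase univ l (mem_univ 0)]
    omega
  have hpos : ∀ H : SimpleGraph (Fin n), H.Connected → ¬ IsEPositive (attachRays H l) :=
    fun H hH he => hpart H
      (he.hasConnectedPartition_pair (attachRays_connected hH) (by omega) (by omega) hcard)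
  have hcycle : (SimpleGraph.cycleGraph n).Connected := by
    obtain ⟨m, rfl⟩ := Nat.exists_eq_succ_of_ne_zero (NeZero.ne n)
    exact SimpleGraph.cycleGraph_connected
  exact ⟨⟨hpart _, hpart _⟩, hpos _ hcycle, hpos _ SimpleGraph.connected_top⟩
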